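/- Let $n, r \ge 1$ be integers. For $k \ge 1$ let $C^k(n)$ denote the ring of germs at $0\in\mathbb{R}^n$ of real-valued functions of class $C^k$ defined near $0$. Let $f, g : (\mathbb{R}^n,0)\to(\mathbb{R},0)$ be functions of class $C^{r+1}$ in a neighbourhood of $0$, with $f(0)=g(0)=0$, and let $\mathcal{J}_f C^r(n)$ be the Jacobi ideal of $f$ in $C^r(n)$, that is, the ideal of $C^r(n)$ generated by the germs of $\frac{\partial f}{\partial x_1},\dots,\frac{\partial f}{\partial x_n}$. If $\nabla f(0)=0$ and $(g-f)\in(\mathcal{J}_f C^r(n))^{r+2}$, then $f$ and $g$ are $C^r$-right equivalent: there is a $C^r$ diffeomorphism $\varphi$ between two open neighbourhoods of $0$ in $\mathbb{R}^n$ (with $C^r$ inverse), $\varphi(0)=0$, such that $f=g\circ\varphi$ in a neighbourhood of $0$. -/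

import Mathlib

open scoped Topology Gradient ContDiff

noncomputable section

/-- The ring `C^k(n)` of germs at the origin of real functions of class `C^k` on `ℝⁿ`
(for finite `k`, `ContDiffAt` at `0` means being `C^k` in a neighbourhood of `0`). -/
def ckGerm (n k : ℕ) : Subring (Filter.Germ (𝓝 (0 : EuclideanSpace ℝ (Fin n))) ℝ) where
  carrier := {a | ∃ u : EuclideanSpace ℝ (Fin n) → ℝ,
    ContDiffAt ℝ (k : WithTop ℕ∞) u 0 ∧ (u : Filter.Germ (𝓝 (0 : EuclideanSpace ℝ (Fin n))) ℝ) = a}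
  mul_mem' := by
    rintro _ _ ⟨u, hu, rfl⟩ ⟨v, hv, rfl⟩
    exact ⟨u * v, hu.mul hv, rfl⟩
  one_mem' := ⟨1, contDiffAt_const, rfl⟩
  add_mem' := by
    rintro _ _ ⟨u, hu, rfl⟩ ⟨v, hv, rfl⟩
    exact ⟨u + v, hu.add hv, rfl⟩
  zero_mem' := ⟨0, contDiffAt_const, rfl⟩
  neg_mem' := by
    rintro _ ⟨u, hu, rfl⟩
    exact ⟨-u, hu.neg, rfl⟩

/-- The germ at the origin of a function of class `C^k`, as an element of `C^k(n)`. -/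
def ckGerm.mk {n k : ℕ} (u : EuclideanSpace ℝ (Fin n) → ℝ)
    (hu : ContDiffAt ℝ (k : WithTop ℕ∞) u 0) : ckGerm n k :=
  ⟨(u : Filter.Germ (𝓝 (0 : EuclideanSpace ℝ (Fin n))) ℝ), u, hu, rfl⟩

/-- The partial derivative `∂f/∂xᵢ`. -/
def partialDeriv {n : ℕ} (i : Fin n) (f : EuclideanSpace ℝ (Fin n) → ℝ) :
    EuclideanSpace ℝ (Fin n) → ℝ :=
  fun x => fderiv ℝ f x (EuclideanSpace.single i 1)

theorem contDiffAt_partialDeriv {n r : ℕ} {f : EuclideanSpace ℝ (Fin n) → ℝ}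
    (hf : ContDiffAt ℝ ((r + 1 : ℕ) : WithTop ℕ∞) f 0) (i : Fin n) :
    ContDiffAt ℝ (r : WithTop ℕ∞) (partialDeriv i f) 0 :=
  (hf.fderiv_right (m := (r : WithTop ℕ∞)) (by push_cast; exact le_rfl)).clm_apply
    contDiffAt_const

/-- The Jacobi ideal of a `C^{r+1}` function `f` in `C^r(n)`: the ideal generated by the
(germs of the) partial derivatives `∂f/∂x₁, …, ∂f/∂xₙ`. -/
def jacobiIdeal {n r : ℕ} (f : EuclideanSpace ℝ (Fin n) → ℝ)
    (hf : ContDiffAt ℝ ((r + 1 : ℕ) : WithTop ℕ∞) f 0) : Ideal (ckGerm n r) :=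
  Ideal.span (Set.range fun i : Fin n =>
    ckGerm.mk (partialDeriv i f) (contDiffAt_partialDeriv hf i))

theorem contDiffAt_sub_of_succ {n r : ℕ} {f g : EuclideanSpace ℝ (Fin n) → ℝ}
    (hf : ContDiffAt ℝ ((r + 1 : ℕ) : WithTop ℕ∞) f 0)
    (hg : ContDiffAt ℝ ((r + 1 : ℕ) : WithTop ℕ∞) g 0) :
    ContDiffAt ℝ (r : WithTop ℕ∞) (g - f) 0 :=
  (hg.sub hf).of_le (by exact_mod_cast Nat.le_succ r)

/-- `f` and `g` are `C^r`-right equivalent at the origin: `f = g ∘ φ` near `0` for some `C^r`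
diffeomorphism `φ`, with `φ(0) = 0`, between two open neighbourhoods of the origin. -/
def RightEquivalent {n : ℕ} (r : ℕ) (f g : EuclideanSpace ℝ (Fin n) → ℝ) : Prop :=
  ∃ φ : OpenPartialHomeomorph (EuclideanSpace ℝ (Fin n)) (EuclideanSpace ℝ (Fin n)),
    (0 : EuclideanSpace ℝ (Fin n)) ∈ φ.source ∧ φ 0 = 0 ∧
    ContDiffOn ℝ (r : WithTop ℕ∞) φ φ.source ∧
    ContDiffOn ℝ (r : WithTop ℕ∞) φ.symm φ.target ∧
    ∀ᶠ x in 𝓝 (0 : EuclideanSpace ℝ (Fin n)), f x = g (φ x)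

end

/-! The diffeomorphism is sought as φ(x) = x + σ(x)∇f(x), with a scalar σ solving g(x + σ(x)∇f(x)) =
f(x) wherever ∇f(x) ≠ 0. Put ρ = ‖∇f‖, which is Lipschitz near 0. Membership in the power r+2 of the
Jacobi ideal gives D^k(g - f) = O(ρ^(r+2-k)) for k ≤ r off the zeros of ρ, and g = f on them. Since
Df is Lipschitz and D(g - f) = O(ρ²), the slope of s ↦ g(x + s∇f(x)) is at least ρ²/2 for |s| ≤ δ,
with δ independent of x (`exists_half_sq_le_fderiv`). The discrepancy O(ρ^(r+2)) is therefore
corrected by some σ = O(ρ^r) (`exists_root`), and implicit differentiation gives D^k σ = O(ρ^(r-k))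
(`weightedClass_root`).

Hence h = σ∇f satisfies D^k h = O(ρ^(r+1-k)). Up to k = r these bounds tend to 0 at the zeros of ρ,
so h, which vanishes there, is C^r across them, however complicated the zero set
(`WeightedClass.contDiffAt`). As h = O(ρ²), Dh(0) = 0 and the inverse function theorem applies to id
+ h.

The estimates live in `WeightedClass`, where orders add under products and drop by one under
differentiation. -/

open Filter Asymptotics

universe u

/-! ### Weights and growth rates off their zeros -/

section Weight

variable {E : Type*} [NormedAddCommGroup E] {F : Type*} [NormedAddCommGroup F]
  {G : Type*} [NormedAddCommGroup G] {H : Type*} [NormedAddCommGroup H]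

/-- A weight: a function that vanishes at the origin and is Lipschitz near it. -/
structure IsWeight (ρ : E → ℝ) : Prop where
  map_zero : ρ 0 = 0
  lipschitz : ∃ K, ∃ s ∈ 𝓝 (0 : E), LipschitzOnWith K ρ s

/-- The neighbourhoods of the origin with the zeros of `ρ` removed. -/
def offZeros (ρ : E → ℝ) : Filter E := 𝓝 0 ⊓ 𝓟 {x | ρ x ≠ 0}

variable {ρ : E → ℝ} {m : ℤ}

theorem eventually_offZeros {p : E → Prop} :
    (∀ᶠ x in offZeros ρ, p x) ↔ ∀ᶠ x in 𝓝 0, ρ x ≠ 0 → p x := eventually_inf_principal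

theorem eventually_ne_offZeros : ∀ᶠ x in offZeros ρ, ρ x ≠ 0 :=
  eventually_offZeros.2 (Eventually.of_forall fun _ h => h)

theorem offZeros_le : offZeros ρ ≤ 𝓝 0 := inf_le_left

theorem IsWeight.eventually_continuousAt (hρ : IsWeight ρ) :
    ∀ᶠ x in 𝓝 (0 : E), ContinuousAt ρ x := by
  obtain ⟨K, s, hs, hK⟩ := hρ.lipschitz
  filter_upwards [eventually_mem_nhds_iff.2 hs] with x hx
  exact hK.continuousOn.continuousAt hx

theorem IsWeight.tendsto (hρ : IsWeight ρ) : Tendsto ρ (offZeros ρ) (𝓝 0) := by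
  have := hρ.eventually_continuousAt.self_of_nhds.tendsto
  rw [hρ.map_zero] at this
  exact this.mono_left offZeros_le

/-- Continuity of ρ near 0 makes its nonvanishing an open condition, so identities valid off the
zeros can be differentiated there. -/
theorem IsWeight.eventually_eventually (hρ : IsWeight ρ) {p : E → Prop}
    (h : ∀ᶠ x in offZeros ρ, p x) : ∀ᶠ x in offZeros ρ, ∀ᶠ y in 𝓝 x, p y := by
  rw [eventually_offZeros] at h ⊢
  filter_upwards [eventually_eventually_nhds.2 h, hρ.eventually_continuousAt] with x hx hc h0
  filter_upwards [hx, hc.eventually_ne h0] with y hy hy0 using hy hy0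

theorem IsWeight.isBigO_zpow (hρ : IsWeight ρ) {m m' : ℤ} (h : m' ≤ m) :
    (fun x => ρ x ^ m) =O[offZeros ρ] fun x => ρ x ^ m' := by
  refine IsBigO.of_bound 1 ?_
  filter_upwards [eventually_ne_offZeros, hρ.tendsto.eventually (Metric.ball_mem_nhds 0 one_pos)]
    with x h0 h1
  rw [one_mul, norm_zpow, norm_zpow]
  rw [dist_zero_right] at h1
  exact zpow_le_zpow_right_of_le_one₀ (norm_pos_iff.2 h0) h1.le h

theorem IsWeight.tendsto_of_isBigO (hρ : IsWeight ρ) {u : E → F} (hm : 1 ≤ m)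
    (hu : u =O[offZeros ρ] fun x => ρ x ^ m) : Tendsto u (offZeros ρ) (𝓝 0) := by
  refine (hu.trans (hρ.isBigO_zpow hm)).trans_tendsto ?_
  simpa using hρ.tendsto

theorem isBigO_zpow_mul {u : E → F} {v : E → G} {w : E → H} {m m' : ℤ} {C : ℝ}
    (hu : u =O[offZeros ρ] fun x => ρ x ^ m) (hv : v =O[offZeros ρ] fun x => ρ x ^ m')
    (hw : ∀ᶠ x in offZeros ρ, ‖w x‖ ≤ C * (‖u x‖ * ‖v x‖)) :
    w =O[offZeros ρ] fun x => ρ x ^ (m + m') := by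
  have h1 : w =O[offZeros ρ] fun x => ‖u x‖ * ‖v x‖ := by
    refine IsBigO.of_bound C ?_
    filter_upwards [hw] with x hx
    rwa [norm_mul, norm_norm, norm_norm]
  refine (h1.trans (hu.norm_left.mul hv.norm_left)).congr' EventuallyEq.rfl ?_
  filter_upwards [eventually_ne_offZeros] with x hx
  rw [zpow_add₀ hx]

end Weight

/-! ### Calculus of weighted classes -/

section WeightedClass

variable {E : Type u} [NormedAddCommGroup E] [NormedSpace ℝ E]
  {F : Type u} [NormedAddCommGroup F] [NormedSpace ℝ F]
  {G : Type u} [NormedAddCommGroup G] [NormedSpace ℝ G]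
  {H : Type u} [NormedAddCommGroup H] [NormedSpace ℝ H]
  {ρ : E → ℝ} {j : ℕ} {m : ℤ}

/-- The functions `u` that are, near the origin and off the zeros of `ρ`, of class `C^j` with
`D^k u = O(ρ ^ (m - k))` for all `k ≤ j`. -/
def WeightedClass (ρ : E → ℝ) : (j : ℕ) → {F : Type u} → [NormedAddCommGroup F] →
    [NormedSpace ℝ F] → ℤ → (E → F) → Prop
  | 0, _, _, _, m, u => (∀ᶠ x in offZeros ρ, ContinuousAt u x) ∧
      u =O[offZeros ρ] fun x => ρ x ^ m
  | j + 1, _, _, _, m, u => (∀ᶠ x in offZeros ρ, DifferentiableAt ℝ u x) ∧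
      (u =O[offZeros ρ] fun x => ρ x ^ m) ∧ WeightedClass ρ j (m - 1) (fderiv ℝ u)

namespace WeightedClass

theorem isBigO {u : E → F} (h : WeightedClass ρ j m u) :
    u =O[offZeros ρ] fun x => ρ x ^ m := by
  cases j with
  | zero => exact h.2
  | succ j => exact h.2.1

theorem continuousAt {u : E → F} (h : WeightedClass ρ j m u) :
    ∀ᶠ x in offZeros ρ, ContinuousAt u x := by
  cases j with
  | zero => exact h.1
  | succ j => exact h.1.mono fun _ hx => hx.continuousAt

theorem zero_of {u : E → F} (h : WeightedClass ρ j m u) : WeightedClass ρ 0 m u :=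
  ⟨h.continuousAt, h.isBigO⟩

theorem of_succ {u : E → F} (h : WeightedClass ρ (j + 1) m u) : WeightedClass ρ j m u := by
  induction j generalizing F m with
  | zero => exact h.zero_of
  | succ j ih => exact ⟨h.1, h.2.1, ih h.2.2⟩

theorem of_le {u : E → F} {i : ℕ} (h : WeightedClass ρ j m u) (hi : i ≤ j) :
    WeightedClass ρ i m u := by
  induction j, hi using Nat.le_induction with
  | base => exact h
  | succ j _ ih => exact ih h.of_succ

theorem mono (hρ : IsWeight ρ) {u : E → F} {m' : ℤ} (h : WeightedClass ρ j m u) (hm : m' ≤ m) :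
    WeightedClass ρ j m' u := by
  induction j generalizing F m m' with
  | zero => exact ⟨h.1, h.2.trans (hρ.isBigO_zpow hm)⟩
  | succ j ih => exact ⟨h.1, h.2.1.trans (hρ.isBigO_zpow hm), ih h.2.2 (by omega)⟩

theorem congr (hρ : IsWeight ρ) {u v : E → F} (h : WeightedClass ρ j m u)
    (huv : u =ᶠ[offZeros ρ] v) : WeightedClass ρ j m v := by
  induction j generalizing F m with
  | zero =>
    refine ⟨?_, h.2.congr' huv EventuallyEq.rfl⟩
    filter_upwards [h.1, hρ.eventually_eventually huv] with x hx hxv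
    exact hx.congr hxv
  | succ j ih =>
    refine ⟨?_, h.2.1.congr' huv EventuallyEq.rfl, ih h.2.2 ?_⟩
    · filter_upwards [h.1, hρ.eventually_eventually huv] with x hx hxv
      exact hx.congr_of_eventuallyEq (EventuallyEq.symm hxv)
    · filter_upwards [hρ.eventually_eventually huv] with x hxv
      exact EventuallyEq.fderiv_eq hxv

theorem succ_of_hasFDerivAt (hρ : IsWeight ρ) {u : E → F} {u' : E → E →L[ℝ] F}
    (hu : u =O[offZeros ρ] fun x => ρ x ^ m)
    (h : ∀ᶠ x in offZeros ρ, HasFDerivAt u (u' x) x) (hu' : WeightedClass ρ j (m - 1) u') :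
    WeightedClass ρ (j + 1) m u :=
  ⟨h.mono fun _ hx => hx.differentiableAt, hu,
    hu'.congr hρ (h.mono fun _ hx => hx.fderiv.symm)⟩

theorem add (hρ : IsWeight ρ) {u v : E → F} (hu : WeightedClass ρ j m u)
    (hv : WeightedClass ρ j m v) : WeightedClass ρ j m (fun x => u x + v x) := by
  induction j generalizing F m with
  | zero =>
    refine ⟨?_, hu.2.add hv.2⟩
    filter_upwards [hu.1, hv.1] with x h1 h2 using h1.add h2
  | succ j ih =>
    refine succ_of_hasFDerivAt hρ (hu.2.1.add hv.2.1) ?_ (ih hu.2.2 hv.2.2)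
    filter_upwards [hu.1, hv.1] with x h1 h2 using h1.hasFDerivAt.add h2.hasFDerivAt

theorem of_contDiffAt (hρ : IsWeight ρ) {u : E → F} (hu : ContDiffAt ℝ j u 0) :
    WeightedClass ρ j 0 u := by
  have hO : u =O[offZeros ρ] fun x => ρ x ^ (0 : ℤ) := by
    simpa using (hu.continuousAt.tendsto.isBigO_one ℝ).mono offZeros_le
  have hev := (hu.eventually (by simp)).filter_mono (offZeros_le (ρ := ρ))
  induction j generalizing F with
  | zero => exact ⟨hev.mono fun x hx => hx.continuousAt, hO⟩
  | succ j ih =>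
    have h' : ContDiffAt ℝ j (fderiv ℝ u) 0 := hu.fderiv_right (by push_cast; exact le_rfl)
    refine ⟨hev.mono fun x hx => hx.differentiableAt (by simp), hO, ?_⟩
    refine (ih h' ?_ ?_).mono hρ (by omega)
    · simpa using (h'.continuousAt.tendsto.isBigO_one ℝ).mono offZeros_le
    · exact (h'.eventually (by simp)).filter_mono offZeros_le

theorem isBigO_bilinear (B : F →L[ℝ] G →L[ℝ] H) {u : E → F} {v : E → G} {m' : ℤ}
    (hu : WeightedClass ρ j m u) (hv : WeightedClass ρ j m' v) :
    (fun x => B (u x) (v x)) =O[offZeros ρ] fun x => ρ x ^ (m + m') :=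
  isBigO_zpow_mul (C := ‖B‖) hu.isBigO hv.isBigO (Eventually.of_forall fun x => by
    simpa [mul_assoc] using B.le_opNorm₂ (u x) (v x))

/-- Leibniz rule: each term of the derivative is again bilinear in u, v and one derivative, but with
values in other spaces; hence the induction over all spaces, in one universe. -/
theorem bilinear (hρ : IsWeight ρ) (B : F →L[ℝ] G →L[ℝ] H) {u : E → F} {v : E → G} {m' : ℤ}
    (hu : WeightedClass ρ j m u) (hv : WeightedClass ρ j m' v) :
    WeightedClass ρ j (m + m') (fun x => B (u x) (v x)) := by
  induction j generalizing F G H m m' with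
  | zero =>
    refine ⟨?_, isBigO_bilinear B hu hv⟩
    filter_upwards [hu.1, hv.1] with x h1 h2
    exact (B.continuous.continuousAt.comp h1).clm_apply h2
  | succ j ih =>
    refine succ_of_hasFDerivAt hρ
      (u' := fun x => B.precompR E (u x) (fderiv ℝ v x) + B.precompL E (fderiv ℝ u x) (v x))
      (isBigO_bilinear B hu hv) ?_ (add hρ ?_ ?_)
    · filter_upwards [hu.1, hv.1] with x h1 h2
      exact B.hasFDerivAt_of_bilinear h1.hasFDerivAt h2.hasFDerivAt
    · rw [add_sub_assoc]
      exact ih (B.precompR E) hu.of_succ hv.2.2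
    · rw [add_sub_right_comm]
      exact ih (B.precompL E) hu.2.2 hv.of_succ

theorem clm_apply (hρ : IsWeight ρ) {u : E → F →L[ℝ] G} {v : E → F} {m' : ℤ}
    (hu : WeightedClass ρ j m u) (hv : WeightedClass ρ j m' v) :
    WeightedClass ρ j (m + m') (fun x => u x (v x)) :=
  bilinear hρ (ContinuousLinearMap.id ℝ (F →L[ℝ] G)) hu hv

theorem clm_comp (hρ : IsWeight ρ) {u : E → G →L[ℝ] H} {v : E → F →L[ℝ] G} {m' : ℤ}
    (hu : WeightedClass ρ j m u) (hv : WeightedClass ρ j m' v) :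
    WeightedClass ρ j (m + m') (fun x => (u x).comp (v x)) :=
  bilinear hρ (ContinuousLinearMap.compL ℝ F G H) hu hv

theorem clm (hρ : IsWeight ρ) (L : F →L[ℝ] G) {u : E → F} (hu : WeightedClass ρ j m u) :
    WeightedClass ρ j m (fun x => L (u x)) := by
  simpa using clm_apply hρ (of_contDiffAt hρ (contDiffAt_const (c := L))) hu

end WeightedClass

end WeightedClass

/-! ### Scalar factors and inverses (ℝ fixes the universe to `Type`) -/

section WeightedClassScalar

variable {E : Type} [NormedAddCommGroup E] [NormedSpace ℝ E]
  {F : Type} [NormedAddCommGroup F] [NormedSpace ℝ F]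
  {G : Type} [NormedAddCommGroup G] [NormedSpace ℝ G]
  {ρ : E → ℝ} {j : ℕ} {m : ℤ}

namespace WeightedClass

theorem smul (hρ : IsWeight ρ) {u : E → ℝ} {v : E → F} {m' : ℤ}
    (hu : WeightedClass ρ j m u) (hv : WeightedClass ρ j m' v) :
    WeightedClass ρ j (m + m') (fun x => u x • v x) :=
  bilinear hρ (ContinuousLinearMap.lsmul ℝ ℝ) hu hv

theorem neg (hρ : IsWeight ρ) {v : E → F} (hv : WeightedClass ρ j m v) :
    WeightedClass ρ j m (fun x => -v x) := by
  simpa using clm hρ (-ContinuousLinearMap.id ℝ F) hv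

/-- D(1/u) = -u⁻² Du has order -2m + (m - 1) = -m - 1, and involves only lower derivatives of 1/u,
so induction on j closes. -/
theorem inv (hρ : IsWeight ρ) {u : E → ℝ} (hu : WeightedClass ρ j m u)
    (h : (fun x => ρ x ^ m) =O[offZeros ρ] u) :
    WeightedClass ρ j (-m) (fun x => (u x)⁻¹) := by
  have h0 : ∀ᶠ x in offZeros ρ, u x ≠ 0 := by
    obtain ⟨C, hC⟩ := h.bound
    filter_upwards [hC, eventually_ne_offZeros] with x hx hx0 h0
    rw [h0, norm_zero, mul_zero, norm_le_zero_iff] at hx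
    exact zpow_ne_zero _ hx0 hx
  have hO : (fun x => (u x)⁻¹) =O[offZeros ρ] fun x => ρ x ^ (-m) := by
    simp only [zpow_neg]
    refine h.inv_rev ?_
    filter_upwards [eventually_ne_offZeros] with x hx h
    exact absurd h (zpow_ne_zero _ hx)
  induction j with
  | zero =>
    refine ⟨?_, hO⟩
    filter_upwards [hu.1, h0] with x hx hx0 using hx.inv₀ hx0
  | succ j ih =>
    have hi := ih hu.of_succ
    have hd := neg hρ (smul hρ (smul hρ hi hi) hu.2.2)
    rw [show -m + -m + (m - 1) = -m - 1 by ring] at hd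
    refine succ_of_hasFDerivAt hρ hO ?_ hd
    filter_upwards [hu.1, h0] with x hx hx0
    refine ((hasDerivAt_inv hx0).comp_hasFDerivAt x hx.hasFDerivAt).congr_fderiv ?_
    rw [neg_smul, smul_eq_mul, ← mul_inv, sq]

end WeightedClass

end WeightedClassScalar

/-! ### Small displacements, and extension by zero across the zeros -/

section Composition

variable {E : Type u} [NormedAddCommGroup E] [NormedSpace ℝ E]
  {F : Type u} [NormedAddCommGroup F] [NormedSpace ℝ F]
  {ρ : E → ℝ} {j : ℕ} {m : ℤ}

namespace WeightedClass

/-- The derivative is (Dp(x + h) - Dp(x))(1 + Dh) + Dp(x) Dh: induction handles the first bracket.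
The extra derivative of p supplies the Lipschitz bound at the last level. -/
theorem comp_add_sub (hρ : IsWeight ρ) {p : E → F} {h : E → E} (hm : 1 ≤ m)
    (hp : ContDiffAt ℝ (j + 1 : ℕ) p 0) (hh : WeightedClass ρ j m h) :
    WeightedClass ρ j m (fun x => p (x + h x) - p x) := by
  have ht : Tendsto (fun x => x + h x) (offZeros ρ) (𝓝 0) := by
    simpa using (tendsto_id.mono_left offZeros_le).add (hρ.tendsto_of_isBigO hm hh.isBigO)
  have hO : (fun x => p (x + h x) - p x) =O[offZeros ρ] fun x => ρ x ^ m := by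
    obtain ⟨K, s, hs, hK⟩ := (hp.of_le (m := 1) (by simp)).exists_lipschitzOnWith
    refine IsBigO.trans (IsBigO.of_bound K ?_) hh.isBigO
    filter_upwards [ht.eventually hs, offZeros_le hs] with x h1 h2
    simpa using hK.norm_sub_le h1 h2
  have hev := hp.eventually (by simp)
  have hev1 := ht.eventually hev
  have hev2 := offZeros_le (ρ := ρ) hev
  induction j generalizing F with
  | zero =>
    refine ⟨?_, hO⟩
    filter_upwards [hev1, hev2, hh.1] with x h1 h2 h3
    refine ContinuousAt.sub ?_ h2.continuousAt
    exact ContinuousAt.comp (f := fun x => x + h x) h1.continuousAt (continuousAt_id.add h3)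
  | succ j ih =>
    have hp' : ContDiffAt ℝ (j + 1 : ℕ) (fderiv ℝ p) 0 :=
      hp.fderiv_right (by push_cast; exact le_rfl)
    have hO' : (fun x => fderiv ℝ p (x + h x) - fderiv ℝ p x) =O[offZeros ρ] fun x => ρ x ^ m := by
      obtain ⟨K, s, hs, hK⟩ := (hp'.of_le (m := 1) (by simp)).exists_lipschitzOnWith
      refine IsBigO.trans (IsBigO.of_bound K ?_) hh.isBigO
      filter_upwards [ht.eventually hs, offZeros_le hs] with x h1 h2
      simpa using hK.norm_sub_le h1 h2
    have hd := ih hp' hh.of_succ hO' (hp'.eventually (by simp))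
      (ht.eventually (hp'.eventually (by simp))) (offZeros_le (hp'.eventually (by simp)))
    have h1 : WeightedClass ρ j 0 (fun x => ContinuousLinearMap.id ℝ E + fderiv ℝ h x) :=
      (of_contDiffAt hρ contDiffAt_const).add hρ (hh.2.2.mono hρ (by omega))
    have h2 := (of_contDiffAt hρ (hp'.of_le (m := j) (by exact_mod_cast Nat.le_succ j))).clm_comp
      hρ hh.2.2
    refine succ_of_hasFDerivAt hρ (u' := fun x => (fderiv ℝ p (x + h x) - fderiv ℝ p x).comp
      (ContinuousLinearMap.id ℝ E + fderiv ℝ h x) + (fderiv ℝ p x).comp (fderiv ℝ h x)) hO ?_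
      (((hd.clm_comp hρ h1).mono hρ (by omega)).add hρ (by simpa using h2))
    filter_upwards [hev1, hev2, hh.1] with x h1 h2 h3
    have h4 := (h1.differentiableAt (by simp)).hasFDerivAt.comp x
      ((hasFDerivAt_id x).add h3.hasFDerivAt)
    refine (h4.sub (h2.differentiableAt (by simp)).hasFDerivAt).congr_fderiv ?_
    ext v
    simp only [sub_apply, add_apply, ContinuousLinearMap.comp_apply,
      ContinuousLinearMap.id_apply, map_add]
    abel

/-- At a zero z, the Lipschitz bound gives ρ(y) = O(‖y - z‖), so u = O(ρ²) is quadratically small.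
-/
theorem hasFDerivAt_zero (hρ : IsWeight ρ) {u : E → F} (hu : WeightedClass ρ j m u) (hm : 2 ≤ m)
    (h0 : ∀ᶠ x in 𝓝 0, ρ x = 0 → u x = 0) :
    ∀ᶠ z in 𝓝 0, ρ z = 0 → HasFDerivAt u (0 : E →L[ℝ] F) z := by
  obtain ⟨K, s, hs, hK⟩ := hρ.lipschitz
  obtain ⟨C, hC⟩ := (hu.isBigO.trans (hρ.isBigO_zpow hm)).bound
  rw [eventually_offZeros] at hC
  have hb : ∀ᶠ x in 𝓝 0, ‖u x‖ ≤ C * ‖ρ x‖ ^ 2 := by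
    filter_upwards [hC, h0] with x h1 h2
    by_cases hx : ρ x = 0
    · simp [h2 hx, hx]
    · simpa [zpow_ofNat] using h1 hx
  filter_upwards [eventually_eventually_nhds.2 hb, eventually_mem_nhds_iff.2 hs, h0]
    with z h1 h2 h3 hz
  have hO : (fun y => u y) =O[𝓝 z] fun y => ‖y - z‖ ^ 2 := by
    have hρ' : (fun y => ρ y) =O[𝓝 z] fun y => ‖y - z‖ := by
      refine IsBigO.of_bound K ?_
      filter_upwards [h2] with y hy
      simpa [hz] using hK.norm_sub_le hy (mem_of_mem_nhds h2)
    refine IsBigO.trans (IsBigO.of_bound C ?_) (hρ'.pow 2)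
    filter_upwards [h1] with y hy
    simpa using hy
  refine HasFDerivAt.of_isLittleO ?_
  simp only [h3 hz, sub_zero, zero_apply]
  refine hO.trans_isLittleO ?_
  have : Tendsto (fun y => y - z) (𝓝 z) (𝓝 0) := by
    simpa using (continuous_sub_right z).tendsto z
  exact (isLittleO_norm_pow_id (E' := E) one_lt_two).comp_tendsto this

/-- Order j + 1 leaves O(ρ) for the j-th derivative, just enough for continuity at the zeros. Since
Du vanishes at the zeros too, the induction passes to Du. -/
theorem contDiffAt (hρ : IsWeight ρ) {u : E → F} (hu : WeightedClass ρ j (j + 1) u)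
    (h0 : ∀ᶠ x in 𝓝 0, ρ x = 0 → u x = 0) : ContDiffAt ℝ j u 0 := by
  induction j generalizing F with
  | zero =>
    have hc : ∀ᶠ z in 𝓝 0, ContinuousAt u z := by
      obtain ⟨C, hC⟩ := hu.2.bound
      rw [eventually_offZeros] at hC
      have hb : ∀ᶠ x in 𝓝 0, ‖u x‖ ≤ C * ‖ρ x‖ := by
        filter_upwards [hC, h0] with x h1 h2
        by_cases hx : ρ x = 0
        · simp [h2 hx, hx]
        · simpa using h1 hx
      filter_upwards [eventually_eventually_nhds.2 hb, eventually_offZeros.1 hu.1,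
        hρ.eventually_continuousAt, h0] with z h1 h2 h3 h4
      by_cases hz : ρ z = 0
      · rw [ContinuousAt, h4 hz]
        refine squeeze_zero_norm' h1 ?_
        simpa [hz] using (h3.norm.tendsto.const_mul C)
      · exact h2 hz
    rw [Nat.cast_zero, contDiffAt_zero]
    exact ⟨_, hc, fun x hx => ContinuousAt.continuousWithinAt hx⟩
  | succ j ih =>
    have hz := hu.hasFDerivAt_zero hρ (by push_cast; omega) h0
    have hd := ih (u := fderiv ℝ u) (by simpa using hu.2.2)
      (hz.mono fun z h1 h2 => (h1 h2).fderiv)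
    rw [show ((j + 1 : ℕ) : WithTop ℕ∞) = j + 1 by push_cast; rfl,
      contDiffAt_succ_iff_hasFDerivAt]
    refine ⟨fderiv ℝ u, ⟨_, ?_, fun x hx => hx⟩, hd⟩
    filter_upwards [hz, eventually_offZeros.1 hu.1] with x h1 h2
    by_cases hx : ρ x = 0
    · exact (h1 hx).differentiableAt.hasFDerivAt
    · exact (h2 hx).hasFDerivAt

/-- Only u itself needs decay: its derivatives are required to be O(ρ^(1-k)) with k ≥ 1, which
boundedness gives. -/
theorem of_contDiffAt_isBigO (hρ : IsWeight ρ) {u : E → F} (hu : ContDiffAt ℝ j u 0)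
    (hO : u =O[offZeros ρ] ρ) : WeightedClass ρ j 1 u := by
  cases j with
  | zero => exact ⟨(of_contDiffAt hρ hu).1, by simpa using hO⟩
  | succ j =>
    refine ⟨(of_contDiffAt hρ hu).1, by simpa using hO, ?_⟩
    exact of_contDiffAt hρ (hu.fderiv_right (by push_cast; exact le_rfl))

end WeightedClass

end Composition

/-! ### Implicit differentiation of a continuous root -/

section Implicit

variable {E : Type*} [NormedAddCommGroup E] [NormedSpace ℝ E]

/-- A continuous solution `σ` of `G (y, σ y) = 0` is differentiable where `∂G/∂t ≠ 0`. -/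
theorem hasFDerivAt_of_implicit {G : E × ℝ → ℝ} {σ : E → ℝ} {x : E} {A : E →L[ℝ] ℝ} {c : ℝ}
    (hc : c ≠ 0)
    (hG : HasFDerivAt G (A.coprod (c • ContinuousLinearMap.id ℝ ℝ)) (x, σ x))
    (hσ : ContinuousAt σ x) (h0 : ∀ᶠ y in 𝓝 x, G (y, σ y) = 0) :
    HasFDerivAt σ (-(c⁻¹ • A)) x := by
  set p : E → E × ℝ := fun y => (y - x, σ y - σ x)
  set e : E → ℝ := fun y => σ y - σ x + c⁻¹ * A (y - x)
  have ht : Tendsto (fun y => (y, σ y)) (𝓝 x) (𝓝 (x, σ x)) := tendsto_id.prodMk_nhds hσ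
  have he : e =o[𝓝 x] p := by
    have h1 := (hG.isLittleO.comp_tendsto ht).const_mul_left (-c⁻¹)
    refine h1.congr' ?_ (Eventually.of_forall fun y => rfl)
    filter_upwards [h0] with y hy
    simp only [Function.comp_apply, hy, h0.self_of_nhds, e, ContinuousLinearMap.coprod_apply,
      Prod.fst_sub, Prod.snd_sub, smul_apply, ContinuousLinearMap.id_apply, smul_eq_mul]
    field_simp
    ring
  -- The error ‖e‖ ≤ ‖p‖/2 is absorbed into the left side, whence the factor 2.
  have hp : p =O[𝓝 x] fun y => y - x := by
    refine IsBigO.of_bound (2 * (1 + |c⁻¹| * ‖A‖)) ?_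
    filter_upwards [he.bound (c := 1 / 2) (by norm_num)] with y hy
    have h1 : ‖p y‖ ≤ ‖y - x‖ + ‖σ y - σ x‖ :=
      max_le (le_add_of_nonneg_right (norm_nonneg _)) (le_add_of_nonneg_left (norm_nonneg _))
    have h2 : ‖σ y - σ x‖ ≤ ‖e y‖ + |c⁻¹| * (‖A‖ * ‖y - x‖) := by
      have h3 : σ y - σ x = e y - c⁻¹ * A (y - x) := by simp [e]
      rw [h3]
      refine (norm_sub_le _ _).trans (add_le_add_right ?_ _)
      rw [norm_mul, Real.norm_eq_abs c⁻¹]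
      gcongr
      exact A.le_opNorm _
    nlinarith
  refine HasFDerivAt.of_isLittleO ((he.trans_isBigO hp).congr_left fun y => ?_)
  simp [e]

end Implicit

/-! ### The weight ‖∇f‖ and the root along the gradient -/

section Root

variable {E : Type} [NormedAddCommGroup E] [InnerProductSpace ℝ E] [CompleteSpace E]
  {f g : E → ℝ} {r : ℕ}

theorem norm_gradient (x : E) : ‖∇ f x‖ = ‖fderiv ℝ f x‖ := by
  rw [gradient, LinearIsometryEquiv.norm_map]

theorem fderiv_apply_gradient (x : E) : fderiv ℝ f x (∇ f x) = ‖∇ f x‖ ^ 2 := by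
  rw [← toDual_gradient, InnerProductSpace.toDual_apply_apply, real_inner_self_eq_norm_sq]

theorem contDiffAt_fderiv_of_succ (hf : ContDiffAt ℝ (r + 1 : ℕ) f 0) :
    ContDiffAt ℝ r (fderiv ℝ f) 0 :=
  hf.fderiv_right (by push_cast; exact le_rfl)

theorem contDiffAt_gradient (hf : ContDiffAt ℝ (r + 1 : ℕ) f 0) : ContDiffAt ℝ r (∇ f) 0 :=
  (InnerProductSpace.toDual ℝ E).symm.contDiff.contDiffAt.comp (0 : E)
    (contDiffAt_fderiv_of_succ hf)

theorem isWeight_norm_gradient (hr : 1 ≤ r) (hf : ContDiffAt ℝ (r + 1 : ℕ) f 0)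
    (h0 : ∇ f 0 = 0) : IsWeight fun x => ‖∇ f x‖ := by
  refine ⟨by simp [h0], ?_⟩
  obtain ⟨K, s, hs, hK⟩ :=
    ((contDiffAt_gradient hf).of_le (m := 1) (by exact_mod_cast hr)).exists_lipschitzOnWith
  exact ⟨_, s, hs, lipschitzWith_one_norm.comp_lipschitzOnWith hK⟩

theorem eventually_add_smul_mem {N : E → E} (hN : ContinuousAt N 0) (h0 : N 0 = 0) {T : Set E}
    (hT : T ∈ 𝓝 0) : ∀ᶠ x in 𝓝 0, ∀ s : ℝ, |s| ≤ 1 → x + s • N x ∈ T := by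
  obtain ⟨ε, hε, hT⟩ := Metric.mem_nhds_iff.1 hT
  have h1 : Tendsto (fun x => ‖x‖ + ‖N x‖) (𝓝 0) (𝓝 0) := by
    simpa [h0] using (continuous_norm.tendsto (0 : E)).add hN.norm.tendsto
  filter_upwards [h1.eventually_lt_const hε] with x hx s hs
  refine hT (mem_ball_zero_iff.2 (lt_of_le_of_lt ((norm_add_le _ _).trans ?_) hx))
  rw [norm_smul, Real.norm_eq_abs]
  nlinarith [norm_nonneg (N x)]

/-- With y = x + s∇f(x), write Dg(y) = Df(x) + (Df(y) - Df(x)) + D(g - f)(y). On ∇f(x) the main term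
is ρ(x)², and each of the others is at most ρ(x)²/4. -/
theorem exists_half_sq_le_fderiv (hr : 1 ≤ r) (hf : ContDiffAt ℝ (r + 1 : ℕ) f 0)
    (hg : ContDiffAt ℝ (r + 1 : ℕ) g 0) (h0 : ∇ f 0 = 0)
    (hd : WeightedClass (fun x => ‖∇ f x‖) r (r + 2) (g - f)) :
    ∃ δ > 0, ∀ᶠ x in offZeros fun x => ‖∇ f x‖, ∀ s : ℝ, |s| ≤ δ →
      DifferentiableAt ℝ g (x + s • ∇ f x) ∧
      ‖∇ f x‖ ^ 2 / 2 ≤ fderiv ℝ g (x + s • ∇ f x) (∇ f x) := by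
  have hρ := isWeight_norm_gradient hr hf h0
  obtain ⟨j, rfl⟩ : ∃ j, r = j + 1 := ⟨r - 1, by omega⟩
  obtain ⟨K, S, hS, hK⟩ := ((contDiffAt_fderiv_of_succ hf).of_le (m := 1)
    (by exact_mod_cast hr)).exists_lipschitzOnWith
  obtain ⟨C, hC, hCb⟩ := (hd.2.2.isBigO.trans
    (hρ.isBigO_zpow (m' := 2) (by push_cast; omega))).exists_pos
  have hCb := eventually_offZeros.1 hCb.bound
  have hN := (contDiffAt_gradient hf).continuousAt
  have hfd := (hf.eventually (by simp)).mono fun x hx => hx.differentiableAt (by simp)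
  have hgd := (hg.eventually (by simp)).mono fun x hx => hx.differentiableAt (by simp)
  have hK0 : (0 : ℝ) ≤ K := K.2
  have hδ : (1 : ℝ) / (4 * (K + 1)) ≤ 1 := by
    rw [div_le_one (by positivity)]; linarith
  refine ⟨1 / (4 * (K + 1)), by positivity, ?_⟩
  have hsm : ∀ᶠ x in 𝓝 (0 : E), ‖∇ f x‖ < 1 / (8 * C) := by
    have := hN.norm.tendsto
    rw [h0, norm_zero] at this
    exact this.eventually_lt_const (by positivity)
  filter_upwards [eventually_ne_offZeros, offZeros_le hsm, offZeros_le hS,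
    offZeros_le (eventually_add_smul_mem hN h0 (hCb.and (hfd.and (hgd.and hS))))]
    with x hx0 hx1 hxS hx s hs
  obtain ⟨h1, h2, h3, h4⟩ := hx s (hs.trans hδ)
  refine ⟨h3, ?_⟩
  have hpos : 0 < ‖∇ f x‖ := lt_of_le_of_ne (norm_nonneg _) (Ne.symm hx0)
  set y := x + s • ∇ f x with hy
  have h5 : ‖fderiv ℝ f y - fderiv ℝ f x‖ ≤ ‖∇ f x‖ / 4 := by
    refine (hK.norm_sub_le h4 hxS).trans ?_
    rw [hy, add_sub_cancel_left, norm_smul, Real.norm_eq_abs, ← mul_assoc]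
    have : K * |s| ≤ 1 / 4 := by
      calc (K : ℝ) * |s| ≤ (K + 1) * (1 / (4 * (K + 1))) := by gcongr; linarith
        _ = 1 / 4 := by field_simp
    nlinarith
  have h6 : ‖∇ f y‖ ≤ 5 / 4 * ‖∇ f x‖ := by
    rw [norm_gradient y]
    have := norm_le_norm_add_norm_sub' (fderiv ℝ f y) (fderiv ℝ f x)
    rw [← norm_gradient x] at this
    linarith
  -- The bound on D(g - f) is only available off the zeros, so y must not be one.
  have h7 : ‖∇ f y‖ ≠ 0 := by
    have := norm_le_norm_add_norm_sub (fderiv ℝ f y) (fderiv ℝ f x)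
    rw [← norm_gradient x, ← norm_gradient y] at this
    intro h
    linarith
  have h8 : ‖fderiv ℝ (g - f) y‖ ≤ ‖∇ f x‖ / 4 := by
    have h9 := h1 h7
    rw [zpow_ofNat, norm_pow, norm_norm] at h9
    refine h9.trans ?_
    calc C * ‖∇ f y‖ ^ 2 ≤ C * (5 / 4 * ‖∇ f x‖) ^ 2 := by gcongr
      _ = C * ‖∇ f x‖ * (25 / 16 * ‖∇ f x‖) := by ring
      _ ≤ C * (1 / (8 * C)) * (25 / 16 * ‖∇ f x‖) := by gcongr
      _ = 25 / 128 * ‖∇ f x‖ := by field_simp; ring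
      _ ≤ _ := by linarith
  have h10 : fderiv ℝ g y = fderiv ℝ f x + (fderiv ℝ f y - fderiv ℝ f x)
      + fderiv ℝ (g - f) y := by
    rw [fderiv_sub h3 h2]; abel
  rw [h10, add_apply, add_apply, fderiv_apply_gradient]
  have h11 := (fderiv ℝ f y - fderiv ℝ f x).le_of_opNorm_le h5 (∇ f x)
  have h12 := (fderiv ℝ (g - f) y).le_of_opNorm_le h8 (∇ f x)
  rw [Real.norm_eq_abs] at h11 h12
  have h13 := neg_abs_le ((fderiv ℝ f y - fderiv ℝ f x) (∇ f x))
  have h14 := neg_abs_le ((fderiv ℝ (g - f) y) (∇ f x))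
  linarith

theorem mul_sub_le_of_half_sq_le {δ : ℝ} {x v : E}
    (h : ∀ s : ℝ, |s| ≤ δ → DifferentiableAt ℝ g (x + s • v) ∧
      ‖v‖ ^ 2 / 2 ≤ fderiv ℝ g (x + s • v) v) {s t : ℝ} (hs : |s| ≤ δ) (ht : |t| ≤ δ)
    (hst : s ≤ t) : ‖v‖ ^ 2 / 2 * (t - s) ≤ g (x + t • v) - g (x + s • v) := by
  have hd : ∀ s : ℝ, |s| ≤ δ →
      HasDerivAt (fun s : ℝ => g (x + s • v)) (fderiv ℝ g (x + s • v) v) s := by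
    intro s hs
    have h1 : HasDerivAt (fun s : ℝ => x + s • v) v s := by
      simpa using ((hasDerivAt_id s).smul_const v).const_add x
    exact (h s hs).1.hasFDerivAt.comp_hasDerivAt s h1
  refine (convex_Icc (-δ) δ).mul_sub_le_image_sub_of_le_deriv (f := fun s : ℝ => g (x + s • v))
    (fun s hs => (hd s (abs_le.2 hs)).continuousAt.continuousWithinAt)
    (fun s hs => (hd s (abs_le.2 (Set.mem_Icc.1 (interior_subset hs)))).differentiableAt.differentiableWithinAt)
    (fun s hs => ?_) s (abs_le.1 hs) t (abs_le.1 ht) hst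
  have hs := abs_le.2 (Set.mem_Icc.1 (interior_subset hs))
  rw [(hd s hs).deriv]
  exact (h s hs).2

theorem mul_abs_sub_le_of_half_sq_le {δ : ℝ} {x v : E}
    (h : ∀ s : ℝ, |s| ≤ δ → DifferentiableAt ℝ g (x + s • v) ∧
      ‖v‖ ^ 2 / 2 ≤ fderiv ℝ g (x + s • v) v) {s t : ℝ} (hs : |s| ≤ δ) (ht : |t| ≤ δ) :
    ‖v‖ ^ 2 / 2 * |t - s| ≤ |g (x + t • v) - g (x + s • v)| := by
  rcases le_total s t with hst | hst
  · rw [abs_of_nonneg (sub_nonneg.2 hst)]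
    exact (mul_sub_le_of_half_sq_le h hs ht hst).trans (le_abs_self _)
  · rw [abs_sub_comm t, abs_sub_comm (g _), abs_of_nonneg (sub_nonneg.2 hst)]
    exact (mul_sub_le_of_half_sq_le h ht hs hst).trans (le_abs_self _)

/-- The slope bound makes the values at s = ±c lie on either side of a; then the intermediate value
theorem. -/
theorem exists_root_of_half_sq_le {δ c a : ℝ} {x v : E}
    (h : ∀ s : ℝ, |s| ≤ δ → DifferentiableAt ℝ g (x + s • v) ∧
      ‖v‖ ^ 2 / 2 ≤ fderiv ℝ g (x + s • v) v) (hc : 0 ≤ c) (hcδ : c ≤ δ)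
    (ha : |g x - a| ≤ ‖v‖ ^ 2 / 2 * c) : ∃ s, |s| ≤ c ∧ g (x + s • v) = a := by
  have hcont : ContinuousOn (fun s : ℝ => g (x + s • v)) (Set.Icc (-c) c) := by
    intro s hs
    have h1 : ContinuousAt (fun s : ℝ => x + s • v) s := by fun_prop
    exact (ContinuousAt.comp (g := g) (f := fun s : ℝ => x + s • v)
      (h s ((abs_le.2 hs).trans hcδ)).1.continuousAt h1).continuousWithinAt
  have h0 : |(0 : ℝ)| ≤ δ := by simpa using hc.trans hcδ
  have hc' : |c| ≤ δ := by rwa [abs_of_nonneg hc]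
  have h1 := mul_sub_le_of_half_sq_le h h0 hc' hc
  have h2 := mul_sub_le_of_half_sq_le h (s := -c) (by rwa [abs_neg]) h0 (by linarith)
  simp only [zero_smul, add_zero, sub_zero, zero_sub, neg_neg] at h1 h2
  obtain ⟨h3, h4⟩ := abs_le.1 ha
  obtain ⟨s, hs, hsa⟩ := intermediate_value_Icc (by linarith : -c ≤ c) hcont
    (show a ∈ Set.Icc _ _ from ⟨by linarith, by linarith⟩)
  exact ⟨s, abs_le.2 hs, hsa⟩

theorem exists_root (hr : 1 ≤ r) (hf : ContDiffAt ℝ (r + 1 : ℕ) f 0)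
    (h0 : ∇ f 0 = 0) (hd : WeightedClass (fun x => ‖∇ f x‖) r (r + 2) (g - f)) {δ : ℝ}
    (hδ : 0 < δ) (h : ∀ᶠ x in offZeros fun x => ‖∇ f x‖, ∀ s : ℝ, |s| ≤ δ →
      DifferentiableAt ℝ g (x + s • ∇ f x) ∧
      ‖∇ f x‖ ^ 2 / 2 ≤ fderiv ℝ g (x + s • ∇ f x) (∇ f x)) :
    ∃ σ : E → ℝ, (σ =O[offZeros fun x => ‖∇ f x‖] fun x => ‖∇ f x‖ ^ (r : ℤ)) ∧
      ∀ᶠ x in offZeros fun x => ‖∇ f x‖, |σ x| ≤ δ ∧ g (x + σ x • ∇ f x) = f x := by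
  have hρ := isWeight_norm_gradient hr hf h0
  obtain ⟨C, hC, hCb⟩ := hd.isBigO.exists_pos
  have hsm : Tendsto (fun x => 2 * C * ‖∇ f x‖ ^ r) (offZeros fun x => ‖∇ f x‖) (𝓝 0) := by
    have := (hρ.tendsto.pow r).const_mul (2 * C)
    rwa [zero_pow (by omega), mul_zero] at this
  have hev : ∀ᶠ x in offZeros fun x => ‖∇ f x‖,
      ∃ s : ℝ, |s| ≤ 2 * C * ‖∇ f x‖ ^ r ∧ |s| ≤ δ ∧ g (x + s • ∇ f x) = f x := by
    filter_upwards [h, hCb.bound, hsm.eventually_lt_const hδ] with x h1 h2 h3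
    -- The radius c is chosen so that (ρ²/2)c = Cρ^(r+2), the bound on |g - f|.
    obtain ⟨s, hs, hsa⟩ := exists_root_of_half_sq_le h1 (c := 2 * C * ‖∇ f x‖ ^ r) (a := f x)
      (by positivity) h3.le (by
        rw [norm_zpow, norm_norm, Real.norm_eq_abs, Pi.sub_apply] at h2
        refine h2.trans_eq ?_
        norm_cast
        ring)
    exact ⟨s, hs, hs.trans h3.le, hsa⟩
  choose! σ hσ using fun x (hx : ∃ s : ℝ, |s| ≤ 2 * C * ‖∇ f x‖ ^ r ∧ |s| ≤ δ ∧
    g (x + s • ∇ f x) = f x) => hx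
  replace hσ := hev.mono hσ
  refine ⟨σ, IsBigO.of_bound (2 * C) (hσ.mono fun x hx => ?_), hσ.mono fun x hx => hx.2⟩
  simpa using hx.1

/-! ### Regularity of the root -/

theorem continuousAt_root (hr : 1 ≤ r) (hf : ContDiffAt ℝ (r + 1 : ℕ) f 0)
    (h0 : ∇ f 0 = 0) {δ : ℝ}
    (h : ∀ᶠ x in offZeros fun x => ‖∇ f x‖, ∀ s : ℝ, |s| ≤ δ →
      DifferentiableAt ℝ g (x + s • ∇ f x) ∧
      ‖∇ f x‖ ^ 2 / 2 ≤ fderiv ℝ g (x + s • ∇ f x) (∇ f x)) {σ : E → ℝ}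
    (hσ : ∀ᶠ x in offZeros fun x => ‖∇ f x‖, |σ x| ≤ δ ∧ g (x + σ x • ∇ f x) = f x) :
    ∀ᶠ x in offZeros fun x => ‖∇ f x‖, ContinuousAt σ x := by
  have hρ := isWeight_norm_gradient hr hf h0
  filter_upwards [hρ.eventually_eventually h, hρ.eventually_eventually hσ, eventually_ne_offZeros,
    offZeros_le (hf.eventually (by simp)),
    offZeros_le ((contDiffAt_gradient hf).eventually (by simp))] with x h1 h2 h3 h4 h5
  have hN := h5.continuousAt
  have hg : ContinuousAt g (x + σ x • ∇ f x) :=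
    (h1.self_of_nhds _ h2.self_of_nhds.1).1.continuousAt
  -- Freezing the parameter at σ(x), the slope bound at y dominates |σ(y) - σ(x)| by this quotient.
  have hlim : Tendsto (fun y => |f y - g (y + σ x • ∇ f y)| / (‖∇ f y‖ ^ 2 / 2)) (𝓝 x) (𝓝 0) := by
    have h6 : ContinuousAt (fun y => g (y + σ x • ∇ f y)) x :=
      ContinuousAt.comp (f := fun y => y + σ x • ∇ f y) hg
        (continuousAt_id.add (hN.const_smul (σ x)))
    have h7 : ContinuousAt (fun y => |f y - g (y + σ x • ∇ f y)| / (‖∇ f y‖ ^ 2 / 2)) x :=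
      (h4.continuousAt.sub h6).abs.div ((hN.norm.pow 2).div_const 2)
        (div_ne_zero (pow_ne_zero 2 h3) two_ne_zero)
    have h8 := h7.tendsto
    rwa [h2.self_of_nhds.2, sub_self, abs_zero, zero_div] at h8
  rw [ContinuousAt, tendsto_iff_norm_sub_tendsto_zero]
  refine squeeze_zero' (Eventually.of_forall fun y => norm_nonneg _) ?_ hlim
  filter_upwards [h1, h2, hN.norm.eventually_ne h3] with y h6 h7 h8
  rw [le_div_iff₀ (by positivity), mul_comm, ← h7.2]
  exact mul_abs_sub_le_of_half_sq_le h6 h2.self_of_nhds.1 h7.1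

theorem hasFDerivAt_root (hr : 1 ≤ r) (hf : ContDiffAt ℝ (r + 1 : ℕ) f 0)
    (h0 : ∇ f 0 = 0) {δ : ℝ}
    (h : ∀ᶠ x in offZeros fun x => ‖∇ f x‖, ∀ s : ℝ, |s| ≤ δ →
      DifferentiableAt ℝ g (x + s • ∇ f x) ∧
      ‖∇ f x‖ ^ 2 / 2 ≤ fderiv ℝ g (x + s • ∇ f x) (∇ f x)) {σ : E → ℝ}
    (hσ : ∀ᶠ x in offZeros fun x => ‖∇ f x‖, |σ x| ≤ δ ∧ g (x + σ x • ∇ f x) = f x) :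
    ∀ᶠ x in offZeros fun x => ‖∇ f x‖, HasFDerivAt σ
      (-((fderiv ℝ g (x + σ x • ∇ f x) (∇ f x))⁻¹ •
        (fderiv ℝ g (x + σ x • ∇ f x) - fderiv ℝ f x +
          σ x • (fderiv ℝ g (x + σ x • ∇ f x)).comp (fderiv ℝ (∇ f) x)))) x := by
  have hρ := isWeight_norm_gradient hr hf h0
  filter_upwards [h, hρ.eventually_eventually hσ, eventually_ne_offZeros,
    offZeros_le (hf.eventually (by simp)),
    offZeros_le ((contDiffAt_gradient hf).eventually (by simp)),
    continuousAt_root hr hf h0 h hσ] with x h1 h2 h3 h4 h5 h6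
  obtain ⟨h7, h8⟩ := h1 _ h2.self_of_nhds.1
  have h9 : 0 < ‖∇ f x‖ ^ 2 / 2 := by positivity
  have hN : HasFDerivAt (∇ f) (fderiv ℝ (∇ f) x) x :=
    (h5.differentiableAt (by simp; omega)).hasFDerivAt
  have hf' : HasFDerivAt f (fderiv ℝ f x) x := (h4.differentiableAt (by simp)).hasFDerivAt
  refine hasFDerivAt_of_implicit (G := fun p => g (p.1 + p.2 • ∇ f p.1) - f p.1)
    (h9.trans_le h8).ne' ?_ h6 (h2.mono fun y hy => sub_eq_zero.2 hy.2)
  have h10 : HasFDerivAt (fun p : E × ℝ => p.1) (ContinuousLinearMap.fst ℝ E ℝ) (x, σ x) :=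
    hasFDerivAt_fst
  have h11 : HasFDerivAt (fun p : E × ℝ => p.2) (ContinuousLinearMap.snd ℝ E ℝ) (x, σ x) :=
    hasFDerivAt_snd
  have h12 := h10.add (h11.smul (HasFDerivAt.comp (f := fun p : E × ℝ => p.1) (x, σ x) hN h10))
  have h13 := HasFDerivAt.comp (f := fun p : E × ℝ => p.1 + p.2 • ∇ f p.1) (x, σ x)
    h7.hasFDerivAt h12
  refine (h13.sub (HasFDerivAt.comp (f := fun p : E × ℝ => p.1) (x, σ x) hf' h10)).congr_fderiv ?_
  ext v
  · simp
    ring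
  · simp

/-- Bootstrap: Dσ is expressed through σ, so control of j derivatives of σ yields j + 1. The inverse
factor has order -2 and the numerator order r + 1, giving r - 1 for Dσ. -/
theorem weightedClass_root (hr : 1 ≤ r) (hf : ContDiffAt ℝ (r + 1 : ℕ) f 0)
    (hg : ContDiffAt ℝ (r + 1 : ℕ) g 0) (h0 : ∇ f 0 = 0)
    (hd : WeightedClass (fun x => ‖∇ f x‖) r (r + 2) (g - f)) {δ : ℝ}
    (h : ∀ᶠ x in offZeros fun x => ‖∇ f x‖, ∀ s : ℝ, |s| ≤ δ →
      DifferentiableAt ℝ g (x + s • ∇ f x) ∧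
      ‖∇ f x‖ ^ 2 / 2 ≤ fderiv ℝ g (x + s • ∇ f x) (∇ f x)) {σ : E → ℝ}
    (hO : σ =O[offZeros fun x => ‖∇ f x‖] fun x => ‖∇ f x‖ ^ (r : ℤ))
    (hσ : ∀ᶠ x in offZeros fun x => ‖∇ f x‖, |σ x| ≤ δ ∧ g (x + σ x • ∇ f x) = f x) :
    WeightedClass (fun x => ‖∇ f x‖) r r σ := by
  have hρ := isWeight_norm_gradient hr hf h0
  have hN : WeightedClass (fun x => ‖∇ f x‖) r 1 (∇ f) :=
    .of_contDiffAt_isBigO hρ (contDiffAt_gradient hf) (isBigO_norm_right.2 (isBigO_refl _ _))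
  have hF : WeightedClass (fun x => ‖∇ f x‖) r 1 (fderiv ℝ f) :=
    .of_contDiffAt_isBigO hρ (contDiffAt_fderiv_of_succ hf)
      (IsBigO.of_bound 1 (Eventually.of_forall fun x => by simp [norm_gradient]))
  have hdiff : ∀ᶠ x in offZeros fun x => ‖∇ f x‖,
      fderiv ℝ (g - f) x = fderiv ℝ g x - fderiv ℝ f x := by
    filter_upwards [offZeros_le (hf.eventually (by simp)), offZeros_le (hg.eventually (by simp))]
      with x h1 h2
    exact fderiv_sub (h2.differentiableAt (by simp)) (h1.differentiableAt (by simp))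
  suffices ∀ j ≤ r, WeightedClass (fun x => ‖∇ f x‖) j r σ from this r le_rfl
  intro j
  induction j with
  | zero => exact fun _ => ⟨continuousAt_root hr hf h0 h hσ, hO⟩
  | succ j ih =>
    intro hj
    have hs := ih (by omega)
    have hh : WeightedClass (fun x => ‖∇ f x‖) j (r + 1) (fun x => σ x • ∇ f x) :=
      hs.smul hρ (hN.of_le (by omega))
    have hGD : WeightedClass (fun x => ‖∇ f x‖) j (r + 1) (fun x => fderiv ℝ g x - fderiv ℝ f x) := by
      have h1 : WeightedClass (fun x => ‖∇ f x‖) (j + 1) (r + 2) (g - f) := hd.of_le hj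
      have h2 := h1.2.2.congr hρ hdiff
      rwa [show (r : ℤ) + 2 - 1 = r + 1 by ring] at h2
    -- Split as (Dg(x + h) - Dg(x)) + D(g - f)(x), with h = σ∇f; both have order r + 1.
    have hβ : WeightedClass (fun x => ‖∇ f x‖) j (r + 1)
        (fun x => fderiv ℝ g (x + σ x • ∇ f x) - fderiv ℝ f x) := by
      have h1 := (WeightedClass.comp_add_sub hρ (by omega)
        ((contDiffAt_fderiv_of_succ hg).of_le (m := (j + 1 : ℕ)) (by exact_mod_cast hj)) hh).add
        hρ hGD
      simpa using h1
    have hβ1 : WeightedClass (fun x => ‖∇ f x‖) j 1 (fun x => fderiv ℝ g (x + σ x • ∇ f x)) := by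
      simpa using (hβ.mono hρ (by omega : (1 : ℤ) ≤ r + 1)).add hρ (hF.of_le (by omega))
    have hDN : WeightedClass (fun x => ‖∇ f x‖) j 0 (fderiv ℝ (∇ f)) := by
      have h1 : WeightedClass (fun x => ‖∇ f x‖) (j + 1) 1 (∇ f) := hN.of_le hj
      exact h1.2.2
    have hA := hβ.add hρ ((hs.smul hρ (hβ1.clm_comp hρ hDN)).mono hρ (by omega))
    have hc := (hβ1.clm_apply hρ (hN.of_le (by omega : j ≤ r))).inv hρ (by
      refine IsBigO.of_bound 2 ?_
      filter_upwards [h, hσ] with x h1 h2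
      have h3 := (h1 _ h2.1).2
      rw [show (1 : ℤ) + 1 = 2 by norm_num, zpow_ofNat, norm_pow, norm_norm]
      linarith [Real.le_norm_self (fderiv ℝ g (x + σ x • ∇ f x) (∇ f x))])
    refine WeightedClass.succ_of_hasFDerivAt hρ hO (hasFDerivAt_root hr hf h0 h hσ) ?_
    exact ((hc.smul hρ hA).neg hρ).mono hρ (by omega)

theorem exists_contDiffAt_comp_add_eq (hr : 1 ≤ r) (hf : ContDiffAt ℝ (r + 1 : ℕ) f 0)
    (hg : ContDiffAt ℝ (r + 1 : ℕ) g 0) (h0 : ∇ f 0 = 0)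
    (hd : WeightedClass (fun x => ‖∇ f x‖) r (r + 2) (g - f))
    (hd0 : ∀ᶠ x in 𝓝 0, ∇ f x = 0 → g x = f x) :
    ∃ h : E → E, ContDiffAt ℝ r h 0 ∧ HasFDerivAt h (0 : E →L[ℝ] E) 0 ∧ h 0 = 0 ∧
      ∀ᶠ x in 𝓝 0, f x = g (x + h x) := by
  have hρ := isWeight_norm_gradient hr hf h0
  obtain ⟨δ, hδ, h⟩ := exists_half_sq_le_fderiv hr hf hg h0 hd
  obtain ⟨σ, hO, hσ⟩ := exists_root hr hf h0 hd hδ h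
  have hs := weightedClass_root hr hf hg h0 hd h hO hσ
  have hN : WeightedClass (fun x => ‖∇ f x‖) r 1 (∇ f) :=
    .of_contDiffAt_isBigO hρ (contDiffAt_gradient hf) (isBigO_norm_right.2 (isBigO_refl _ _))
  have hh := hs.smul hρ hN
  -- The value of σ at a zero of ∇f is arbitrary and harmless.
  have hz : ∀ᶠ x in 𝓝 (0 : E), ‖∇ f x‖ = 0 → σ x • ∇ f x = 0 :=
    Eventually.of_forall fun x hx => by rw [norm_eq_zero.1 hx, smul_zero]
  refine ⟨fun x => σ x • ∇ f x, hh.contDiffAt hρ hz,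
    (hh.hasFDerivAt_zero hρ (by omega) hz).self_of_nhds (by simp [h0]), by simp [h0], ?_⟩
  filter_upwards [eventually_offZeros.1 hσ, hd0] with x h1 h2
  by_cases hx : ∇ f x = 0
  · simp [hx, h2 hx]
  · exact (h1 (norm_ne_zero_iff.2 hx)).2.symm

end Root

/-! ### From powers of the Jacobi ideal to weighted orders -/

section Germs

variable {n r : ℕ}

/-- The germs in `C^r(n)` that have a representative in the weighted class of order `m` which,
if `m ≠ 0`, vanishes at the zeros of the weight. -/
def HasWeightedRep (ρ : EuclideanSpace ℝ (Fin n) → ℝ) (m : ℕ) (a : ckGerm n r) : Prop :=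
  ∃ u : EuclideanSpace ℝ (Fin n) → ℝ,
    (u : Germ (𝓝 (0 : EuclideanSpace ℝ (Fin n))) ℝ) = a ∧ WeightedClass ρ r m u ∧
      (m ≠ 0 → ∀ᶠ x in 𝓝 0, ρ x = 0 → u x = 0)

namespace HasWeightedRep

variable {ρ : EuclideanSpace ℝ (Fin n) → ℝ} {m k : ℕ} {a b : ckGerm n r}

theorem of_germ (hρ : IsWeight ρ) (a : ckGerm n r) : HasWeightedRep ρ 0 a := by
  obtain ⟨u, hu, hua⟩ := a.2
  exact ⟨u, hua, .of_contDiffAt hρ hu, fun h => absurd rfl h⟩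

theorem add (hρ : IsWeight ρ) (ha : HasWeightedRep ρ m a) (hb : HasWeightedRep ρ m b) :
    HasWeightedRep ρ m (a + b) := by
  obtain ⟨u, hua, hu, hu0⟩ := ha
  obtain ⟨v, hvb, hv, hv0⟩ := hb
  refine ⟨fun x => u x + v x, ?_, hu.add hρ hv, fun hm => ?_⟩
  · rw [Subring.coe_add, ← hua, ← hvb]
    rfl
  · filter_upwards [hu0 hm, hv0 hm] with x h1 h2 hx
    rw [h1 hx, h2 hx, add_zero]

theorem mul (hρ : IsWeight ρ) (ha : HasWeightedRep ρ m a) (hb : HasWeightedRep ρ k b) :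
    HasWeightedRep ρ (m + k) (a * b) := by
  obtain ⟨u, hua, hu, hu0⟩ := ha
  obtain ⟨v, hvb, hv, hv0⟩ := hb
  refine ⟨fun x => u x • v x, ?_, by push_cast; exact hu.smul hρ hv, fun hm => ?_⟩
  · rw [Subring.coe_mul, ← hua, ← hvb]
    rfl
  · by_cases h : m = 0
    · filter_upwards [hv0 (by omega)] with x h1 hx
      rw [h1 hx, smul_zero]
    · filter_upwards [hu0 h] with x h1 hx
      rw [h1 hx, zero_smul]

theorem zero (hρ : IsWeight ρ) : HasWeightedRep ρ 1 (0 : ckGerm n r) :=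
  ⟨0, rfl, .of_contDiffAt_isBigO hρ contDiffAt_const (isBigO_zero _ _),
    fun _ => Eventually.of_forall fun _ _ => rfl⟩

theorem of_mem_span (hρ : IsWeight ρ) {S : Set (ckGerm n r)} (hS : ∀ b ∈ S, HasWeightedRep ρ 1 b)
    (ha : a ∈ Ideal.span S) : HasWeightedRep ρ 1 a := by
  induction ha using Submodule.span_induction with
  | mem b hb => exact hS b hb
  | zero => exact zero hρ
  | add a b _ _ ha hb => exact ha.add hρ hb
  | smul a b _ hb => simpa using (of_germ hρ a).mul hρ hb

/-- Orders add under products and survive sums. Vanishing on the zeros is carried along because the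
weighted bounds say nothing there. -/
theorem of_mem_pow (hρ : IsWeight ρ) {I : Ideal (ckGerm n r)}
    (hI : ∀ b ∈ I, HasWeightedRep ρ 1 b) (ha : a ∈ I ^ m) : HasWeightedRep ρ m a := by
  induction m generalizing a with
  | zero => exact of_germ hρ a
  | succ m ih =>
    rw [pow_succ] at ha
    induction ha using Submodule.mul_induction_on' with
    | mem_mul_mem b hb c hc => exact (ih hb).mul hρ (hI c hc)
    | add b _ c _ hb hc => exact hb.add hρ hc

end HasWeightedRep

theorem hasWeightedRep_partialDeriv {f : EuclideanSpace ℝ (Fin n) → ℝ} (hr : 1 ≤ r)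
    (hf : ContDiffAt ℝ (r + 1 : ℕ) f 0) (h0 : ∇ f 0 = 0) (i : Fin n) :
    HasWeightedRep (fun x => ‖∇ f x‖) 1
      (ckGerm.mk (partialDeriv i f) (contDiffAt_partialDeriv hf i) : ckGerm n r) := by
  refine ⟨partialDeriv i f, rfl, ?_, fun _ => Eventually.of_forall fun x hx => ?_⟩
  · refine .of_contDiffAt_isBigO (isWeight_norm_gradient hr hf h0) (contDiffAt_partialDeriv hf i)
      (IsBigO.of_bound ‖EuclideanSpace.single i (1 : ℝ)‖ (Eventually.of_forall fun x => ?_))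
    rw [norm_norm, norm_gradient, mul_comm]
    exact (fderiv ℝ f x).le_opNorm _
  · have h1 : fderiv ℝ f x = 0 := norm_eq_zero.1 ((norm_gradient x).symm.trans hx)
    simp [partialDeriv, h1]

end Germs

/-! ### Inverse function theorem and conclusion -/

theorem exists_openPartialHomeomorph_add {E : Type*} [NormedAddCommGroup E] [NormedSpace ℝ E]
    [CompleteSpace E] {r : ℕ} (hr : 1 ≤ r) {h : E → E} (hh : ContDiffAt ℝ r h 0)
    (hd : HasFDerivAt h (0 : E →L[ℝ] E) 0) :
    ∃ φ : OpenPartialHomeomorph E E, (∀ x, φ x = x + h x) ∧ 0 ∈ φ.source ∧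
      ContDiffOn ℝ r φ φ.source ∧ ContDiffOn ℝ r φ.symm φ.target := by
  have hc : ContDiffAt ℝ r (fun x => x + h x) 0 := contDiffAt_id.add hh
  have hd' : HasFDerivAt (fun x => x + h x) ((ContinuousLinearEquiv.refl ℝ E : E ≃L[ℝ] E) :
      E →L[ℝ] E) 0 := by
    refine ((hasFDerivAt_id (𝕜 := ℝ) (0 : E)).add hd).congr_fderiv ?_
    simp
  have hr0 : (r : WithTop ℕ∞) ≠ 0 := by exact_mod_cast (by omega : r ≠ 0)
  have hr1 : (r : WithTop ℕ∞) ≠ ∞ := by simp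
  -- The local inverse is restricted to the points where the map and its inverse are both C^r, an
  -- open condition because r is finite.
  refine ⟨(hc.toOpenPartialHomeomorph _ hd' hr0).restrContDiff ℝ r hr1, fun x => rfl,
    ⟨hc.mem_toOpenPartialHomeomorph_source hd' hr0, hc, hc.to_localInverse hd' hr0⟩,
    OpenPartialHomeomorph.contDiffOn_restrContDiff_source _ _ hr1,
    OpenPartialHomeomorph.contDiffOn_restrContDiff_target _ _ hr1⟩

theorem mainTheorem2 (n r : ℕ) (hr : 1 ≤ r) (f g : EuclideanSpace ℝ (Fin n) → ℝ)
    (hf : ContDiffAt ℝ ((r + 1 : ℕ) : WithTop ℕ∞) f 0)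
    (hg : ContDiffAt ℝ ((r + 1 : ℕ) : WithTop ℕ∞) g 0)
    (hf0 : f 0 = 0) (hg0 : g 0 = 0)
    (hgrad : ∇ f 0 = 0)
    (hmem : ckGerm.mk (g - f) (contDiffAt_sub_of_succ hf hg) ∈ jacobiIdeal f hf ^ (r + 2)) :
    RightEquivalent r f g := by
  have hρ := isWeight_norm_gradient hr hf hgrad
  obtain ⟨u, hua, hu, hu0⟩ := HasWeightedRep.of_mem_pow hρ (fun b hb =>
    HasWeightedRep.of_mem_span hρ
      (Set.forall_mem_range.2 (hasWeightedRep_partialDeriv hr hf hgrad)) hb) hmem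
  have hud : u =ᶠ[𝓝 0] g - f := Germ.coe_eq.1 hua
  obtain ⟨h, hh, hd, h0, hfg⟩ := exists_contDiffAt_comp_add_eq hr hf hg hgrad
    (by simpa using hu.congr hρ (hud.filter_mono offZeros_le)) (by
      filter_upwards [hud, hu0 (by omega)] with x h1 h2 hx
      rw [h2 (by simp [hx]), Pi.sub_apply] at h1
      exact (sub_eq_zero.1 h1.symm))
  obtain ⟨φ, hφ, hφ0, hφs, hφt⟩ := exists_openPartialHomeomorph_add hr hh hd
  exact ⟨φ, hφ0, by simp [hφ, h0], hφs, hφt, hfg.mono fun x hx => by rw [hx, hφ]⟩
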